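/- Let $(\varepsilon_t)_{t\in\mathbb Z}$ be i.i.d. random variables on a probability space $(\Omega,\mathcal A,P)$ with continuous distribution, $E(\varepsilon_t)=0$ and $E(\varepsilon_t^2)=1$. Let $0<C<1$, $d_u<\tfrac12$, $0<a_d<a_u<\infty$, let $b_j(c,d)=c\,j^{d-1}$ for $j\ge 1$ and $$\Theta=\Big\{\theta=(d,c,a):\ 0\le d\le d_u,\ 0\le c\le c_u(d),\ a_d\le a\le a_u\Big\},\qquad c_u(d)=C\Big(\sum_{j=1}^\infty j^{2d-2}\Big)^{-1/2}.$$ Let $\theta_0=(d_0,c_0,a_0)\in\Theta$ and let $(X_t,\sigma_t)_{t\in\mathbb Z}$ be a strictly and second order stationary, nonanticipative LARCH process with parameter $\theta_0$, that is, $X_t=\varepsilon_t\sigma_t$ and $\sigma_t=a_0+\sum_{j\ge1}b_j(c_0,d_0)X_{t-j}$ almost surely for all $t$, with $X_t,\sigma_t\in L^2(P)$ and $\varepsilon_t$ independent of $(X_u)_{u<t}$. For $\theta=(d,c,a)\in\Theta$ let the random variable $\sigma_t(\theta)$ be a version of $a+\sum_{j=1}^\infty b_j(c,d)X_{t-j}$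 (these two series being understood as limits in probability of their partial sums), and assume that, for every $t\in\mathbb Z$, the process $(\sigma_t(\theta))_{\theta\in\Theta}$ is separable: for every relatively open $A\subset\Theta$ and every closed interval $B=[x,y]$ the sets $\{\omega:\sigma_t(\theta)\in B\ \forall\theta\in A\}$ and $\{\omega:\sigma_t(\theta)\in B\ \forall\theta\in A\cap\mathbb Q^3\}$ differ only by a subset of a null set. Then, for every $t\in\mathbb Z$, almost surely the function $\theta\mapsto\sigma_t(\theta)$ is infinitely often differentiable on $\Theta$, and for all $k\ge1$ and all $\theta=(d,c,a)\in\Theta$ for which $\{d':(d',c,a)\in\Theta\}$ has more than one point, $$\frac{\partial^k}{\partial d^k}\sigma_t(\theta)=\sum_{j=1}^\infty\frac{\partial^k}{\partial d^k}b_j(c,d)\,X_{t-j}$$ (the derivative is one-sided at an end point of $\{d':(d',c,a)\in\Theta\}$). The partial sums of the series on the right converge almost surely, with one exceptional null set for all such $k$ and $\theta$, and also, for each such $k$ and $\theta$, in $L^2(P)$. -/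

import Mathlib

open MeasureTheory ProbabilityTheory Filter Topology

namespace LARCH

noncomputable section

/-- The coefficients `b_j(c, d) = c j^(d-1)`, used for `j ≥ 1`. -/
def coef (c d : ℝ) (j : ℕ) : ℝ := c * (j : ℝ) ^ (d - 1)

/-- The upper bound `c_u(d) = C (∑_{j ≥ 1} j^(2d-2))^(-1/2)`. -/
def cUpper (C d : ℝ) : ℝ := C * (∑' j : ℕ, ((j : ℝ) + 1) ^ (2 * d - 2)) ^ (-(1 / 2) : ℝ)

/-- The parameter set `Θ` of all `θ = (d, c, a)` with `d ∈ [0, d_u]`, `c ∈ [0, c_u(d)]` and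
`a ∈ [a_d, a_u]`. -/
def paramSet (C d_u a_d a_u : ℝ) : Set (ℝ × ℝ × ℝ) :=
  {θ | θ.1 ∈ Set.Icc 0 d_u ∧ θ.2.1 ∈ Set.Icc 0 (cUpper C θ.1) ∧ θ.2.2 ∈ Set.Icc a_d a_u}

/-- The points of `ℝ³` with rational coordinates. -/
def rationalPoints : Set (ℝ × ℝ × ℝ) :=
  Set.range fun q : ℚ × ℚ × ℚ => ((q.1 : ℝ), (q.2.1 : ℝ), (q.2.2 : ℝ))

variable {Ω : Type*} [MeasurableSpace Ω]

/-- The innovations: i.i.d. random variables with a continuous distribution (no atoms), mean zero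
and variance one. -/
structure IsInnovation (P : Measure Ω) (ε : ℤ → Ω → ℝ) : Prop where
  measurable : ∀ t, Measurable (ε t)
  indep : iIndepFun ε P
  identDistrib : ∀ s t, IdentDistrib (ε s) (ε t) P P
  noAtoms : ∀ t x, P {ω | ε t ω = x} = 0
  memLp : ∀ t, MemLp (ε t) 2 P
  mean : ∀ t, ∫ ω, ε t ω ∂P = 0
  second_moment : ∀ t, ∫ ω, (ε t ω) ^ 2 ∂P = 1

/-- The random variable `Y` is (a version of) `a + ∑_{j ≥ 1} b_j X_{t-j}`: the partial sums
converge to it in probability. In particular this holds if they converge to it in mean square or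
almost surely. -/
def IsVolatilitySum (P : Measure Ω) (X : ℤ → Ω → ℝ) (a : ℝ) (b : ℕ → ℝ) (t : ℤ)
    (Y : Ω → ℝ) : Prop :=
  TendstoInMeasure P
    (fun (n : ℕ) ω => a + ∑ j ∈ Finset.Icc 1 n, b j * X (t - (j : ℤ)) ω) atTop Y

/-- `(X_t, s_t)` is a strictly and second order stationary LARCH process with innovations `ε`,
intercept `a` and coefficients `b`: it solves `X_t = ε_t s_t`, `s_t = a + ∑_{j ≥ 1} b_j X_{t-j}`,
and it is nonanticipative, i.e. `ε_t` is independent of the past `(X_u)_{u < t}`. -/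
structure IsStationaryLARCH (P : Measure Ω) (ε : ℤ → Ω → ℝ) (a : ℝ) (b : ℕ → ℝ)
    (X s : ℤ → Ω → ℝ) : Prop where
  measurable_X : ∀ t, Measurable (X t)
  measurable_s : ∀ t, Measurable (s t)
  observation : ∀ t, X t =ᵐ[P] fun ω => ε t ω * s t ω
  volatility : ∀ t, IsVolatilitySum P X a b t (s t)
  memLp_X : ∀ t, MemLp (X t) 2 P
  memLp_s : ∀ t, MemLp (s t) 2 P
  stationary : ∀ h : ℤ, IdentDistrib (fun ω (t : ℤ) => (X t ω, s t ω))
    (fun ω (t : ℤ) => (X (t + h) ω, s (t + h) ω)) P P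
  nonanticipative : ∀ t : ℤ, IndepFun (ε t) (fun ω (u : Set.Iio t) => X u ω) P

/-- Separability of a process indexed by `Θ`, with the rational points as separating set: for every
relatively open `U ∩ Θ` and every closed interval `[x, y]`, the events that the process lies in
`[x, y]` on all of `U ∩ Θ`, respectively at the rational points of `U ∩ Θ`, differ by a subset of a
null set. -/
def IsSeparableProcess (P : Measure Ω) (Θ : Set (ℝ × ℝ × ℝ))
    (ξ : (ℝ × ℝ × ℝ) → Ω → ℝ) : Prop :=
  ∀ U : Set (ℝ × ℝ × ℝ), IsOpen U → ∀ x y : ℝ, x ≤ y →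
    ∀ᵐ ω ∂P, (∀ θ ∈ U ∩ Θ, ξ θ ω ∈ Set.Icc x y) ↔
      (∀ θ ∈ U ∩ Θ ∩ rationalPoints, ξ θ ω ∈ Set.Icc x y)

/-- The section `{d | (d, c, a) ∈ Θ}`. -/
def dSection (Θ : Set (ℝ × ℝ × ℝ)) (c a : ℝ) : Set ℝ := {d | (d, c, a) ∈ Θ}

/-- The `k`-th partial derivative with respect to `d`, at `(d, c, a)`, of a function on `Θ`
(one-sided at the end points of the section). -/
def partialD (Θ : Set (ℝ × ℝ × ℝ)) (k : ℕ) (f : ℝ × ℝ × ℝ → ℝ) (d c a : ℝ) : ℝ :=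
  iteratedDerivWithin k (fun d' => f (d', c, a)) (dSection Θ c a) d

/-- The partial sum `∑_{j=1}^n (∂^k/∂d^k) b_j(c, d) X_{t-j}` of the termwise differentiated
series. -/
def derivPartialSum (X : ℤ → Ω → ℝ) (t : ℤ) (k : ℕ) (d c : ℝ) (n : ℕ) (ω : Ω) : ℝ :=
  ∑ j ∈ Finset.Icc 1 n, iteratedDeriv k (fun d' => coef c d' j) d * X (t - (j : ℤ)) ω

end

end LARCH

/-! Formally `σ_t(θ) = a + c * H(d)` with the random Dirichlet series `H(d) = ∑ j ^ (d - 1)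
X_{t-j}`, so everything reduces to a function of `d` alone.

The observations are orthogonal with constant second moment, because `ε_t` is centred and
independent of the past. A dyadic maximal inequality of Rademacher–Menshov type then bounds their
partial sums almost surely by `K * n ^ γ`, for any `γ > 1 / 2` (`ae_exists_abs_sum_range_le_rpow`).
On this single event the rest is deterministic: by Abel summation the series converges locally
uniformly on the complex half plane `re z < 1 - γ`, and Weierstrass' theorem gives a holomorphic sum
and termwise derivatives of every order (`exists_contDiffOn_dirichlet`). With `γ = 1 - r` and `d_u <
r < 1 / 2` this covers all `d ≤ d_u`.

Each `σ_t(θ)` is only a version of the series. It agrees with `a + c * H(d)` at the countably many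
rational points, and separability together with continuity extends this to all of `Θ` outside one
null set (`IsSeparableProcess.ae_eqOn`). Mean square convergence follows from orthogonality, since
the coefficients `c (log j)^k j^(d-1)` are square summable for `d < 1 / 2`. -/

namespace LARCH

/-! ### Dirichlet series whose coefficients have slowly growing partial sums -/

/-- Summation by parts for sums over `1 ≤ j ≤ n`. -/
lemma sum_Icc_mul_by_parts {R : Type*} [CommRing R] (x b : ℕ → R) (n : ℕ) :
    ∑ j ∈ Finset.Icc 1 n, x j * b j =
      (∑ j ∈ Finset.Icc 1 n, x j) * b n +
        ∑ m ∈ Finset.range n, (∑ j ∈ Finset.Icc 1 m, x j) * (b m - b (m + 1)) := by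
  induction n with
  | zero => simp
  | succ n ih =>
    rw [Finset.sum_Icc_succ_top (by omega), Finset.sum_Icc_succ_top (by omega), ih,
      Finset.sum_range_succ]
    ring

/-- Mean value inequality on `[m, m + 1]`: the derivative `w * y ^ (w - 1)` has its largest modulus
at the left end. -/
lemma norm_natCast_cpow_sub_le {w : ℂ} (hw : w.re < 0) {m : ℕ} (hm : 0 < m) :
    ‖(m : ℂ) ^ w - ((m + 1 : ℕ) : ℂ) ^ w‖ ≤ ‖w‖ * (m : ℝ) ^ (w.re - 1) := by
  have hm' : (0 : ℝ) < m := by exact_mod_cast hm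
  have hw0 : w ≠ 0 := fun h => by simp [h] at hw
  have := norm_image_sub_le_of_norm_deriv_le_segment' (f := fun y : ℝ => (y : ℂ) ^ w)
    (f' := fun y : ℝ => w * (y : ℂ) ^ (w - 1)) (a := m) (b := m + 1)
    (C := ‖w‖ * (m : ℝ) ^ (w.re - 1)) ?_ ?_ (m + 1) ⟨by linarith, le_rfl⟩
  · rw [norm_sub_rev]
    simpa using this
  · intro y hy
    exact (hasDerivAt_ofReal_cpow_const (hm'.trans_le hy.1).ne' hw0).hasDerivWithinAt
  · intro y hy
    have hy0 : 0 < y := hm'.trans_le hy.1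
    rw [norm_mul, Complex.norm_cpow_eq_rpow_re_of_pos hy0]
    gcongr ‖w‖ * ?_
    exact Real.rpow_le_rpow_of_nonpos hm' hy.1 (by simp; linarith)

/-- If the partial sums of `x` grow at most like `n ^ γ`, then the Dirichlet series
`∑ x_j j ^ (z - 1)` converges locally uniformly on the half plane `re z < 1 - γ`. -/
lemma exists_tendstoLocallyUniformlyOn_dirichlet {x : ℕ → ℝ} {γ K : ℝ} (hγ : 0 ≤ γ)
    (hx : ∀ n : ℕ, |∑ j ∈ Finset.Icc 1 n, x j| ≤ K * (n : ℝ) ^ γ) :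
    ∃ F : ℂ → ℂ, TendstoLocallyUniformlyOn
      (fun (n : ℕ) (z : ℂ) => ∑ j ∈ Finset.Icc 1 n, (x j : ℂ) * (j : ℂ) ^ (z - 1)) F atTop
      {z | z.re < 1 - γ} := by
  set T : ℕ → ℂ := fun n => ∑ j ∈ Finset.Icc 1 n, (x j : ℂ) with hT
  have hTn : ∀ n : ℕ, ‖T n‖ ≤ K * (n : ℝ) ^ γ := fun n => by
    have : T n = ((∑ j ∈ Finset.Icc 1 n, x j : ℝ) : ℂ) := by simp [hT]
    rw [this, Complex.norm_real]
    exact hx n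
  have hK : 0 ≤ K := by simpa using (abs_nonneg _).trans (hx 1)
  -- This is what Abel summation leaves once the boundary term `T n * n ^ (z - 1)` has tended to 0.
  refine ⟨fun z => ∑' m : ℕ, T m * ((m : ℂ) ^ (z - 1) - ((m + 1 : ℕ) : ℂ) ^ (z - 1)), ?_⟩
  have hopen : IsOpen {z : ℂ | z.re < 1 - γ} := isOpen_lt Complex.continuous_re continuous_const
  rw [tendstoLocallyUniformlyOn_iff_forall_isCompact hopen]
  intro S hS hSc
  rcases S.eq_empty_or_nonempty with rfl | hne
  · exact tendstoUniformlyOn_empty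
  obtain ⟨z₀, hz₀, hmax⟩ := hSc.exists_isMaxOn hne Complex.continuous_re.continuousOn
  set ρ := z₀.re with hρ
  have hργ : ρ < 1 - γ := hS hz₀
  have hmax' : ∀ z ∈ S, z.re ≤ ρ := fun z hz => hmax hz
  obtain ⟨R, hR⟩ := hSc.exists_bound_of_continuousOn
    (f := fun z : ℂ => z - 1) (by fun_prop)
  have hR0 : 0 ≤ R := (norm_nonneg _).trans (hR z₀ hz₀)
  -- The factor `m ^ γ` from `T m` meets `m ^ (ρ - 2)` from the difference of powers; the exponent
  -- is below `-1` because `ρ < 1 - γ`.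
  have hsum : Summable fun m : ℕ => K * R * (m : ℝ) ^ (γ + ρ - 2) :=
    (Real.summable_nat_rpow.2 (by linarith)).mul_left _
  have h1 := tendstoUniformlyOn_tsum_nat hsum (s := S)
    (f := fun (m : ℕ) (z : ℂ) => T m * ((m : ℂ) ^ (z - 1) - ((m + 1 : ℕ) : ℂ) ^ (z - 1))) (by
      intro m z hz
      rcases Nat.eq_zero_or_pos m with rfl | hm
      · simp only [hT, norm_mul]
        simp
        positivity
      have hm' : (1 : ℝ) ≤ m := by exact_mod_cast hm
      have hzr := hmax' z hz
      have h2 := norm_natCast_cpow_sub_le (w := z - 1) (by simp; linarith) hm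
      rw [norm_mul]
      calc ‖T m‖ * ‖(m : ℂ) ^ (z - 1) - ((m + 1 : ℕ) : ℂ) ^ (z - 1)‖
          ≤ (K * (m : ℝ) ^ γ) * (R * (m : ℝ) ^ (ρ - 2)) := by
            refine mul_le_mul (hTn m) (h2.trans ?_) (norm_nonneg _) (by positivity)
            refine mul_le_mul (hR z hz) ?_ (by positivity) hR0
            exact Real.rpow_le_rpow_of_exponent_le hm' (by simp; linarith)
        _ = K * R * (m : ℝ) ^ (γ + ρ - 2) := by
            rw [show γ + ρ - 2 = γ + (ρ - 2) by ring, Real.rpow_add (by linarith)]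
            ring)
  have h2 : TendstoUniformlyOn (fun (n : ℕ) (z : ℂ) => T n * (n : ℂ) ^ (z - 1))
      (fun _ => 0) atTop S := by
    rw [Metric.tendstoUniformlyOn_iff]
    intro e he
    have hlim : Tendsto (fun n : ℕ => K * (n : ℝ) ^ (-(1 - γ - ρ))) atTop (𝓝 0) := by
      simpa using ((tendsto_rpow_neg_atTop (y := 1 - γ - ρ) (by linarith)).comp
        tendsto_natCast_atTop_atTop).const_mul K
    filter_upwards [hlim.eventually_lt_const he, eventually_ge_atTop 1] with n hn hn1 z hz
    have hn' : (1 : ℝ) ≤ n := by exact_mod_cast hn1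
    rw [dist_zero_left, norm_mul, Complex.norm_natCast_cpow_of_pos hn1]
    refine lt_of_le_of_lt ?_ hn
    calc ‖T n‖ * (n : ℝ) ^ (z - 1).re ≤ (K * (n : ℝ) ^ γ) * (n : ℝ) ^ (ρ - 1) := by
          refine mul_le_mul (hTn n) ?_ (by positivity) (by positivity)
          exact Real.rpow_le_rpow_of_exponent_le hn' (by simpa using hmax' z hz)
      _ = K * (n : ℝ) ^ (-(1 - γ - ρ)) := by
          rw [show -(1 - γ - ρ) = γ + (ρ - 1) by ring, Real.rpow_add (by linarith)]
          ring
  have h3 := h2.add h1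
  refine (h3.congr (Eventually.of_forall fun n z _ => ?_)).congr_right fun z _ => ?_
  · simp only [Pi.add_apply]
    rw [sum_Icc_mul_by_parts (fun j => (x j : ℂ)) (fun j => (j : ℂ) ^ (z - 1)) n]
  · simp

lemma iteratedDeriv_re_comp_ofReal {F : ℂ → ℂ} {r : ℝ}
    (hF : DifferentiableOn ℂ F {z | z.re < r}) (k : ℕ) {d : ℝ} (hd : d < r) :
    iteratedDeriv k (fun y : ℝ => (F y).re) d = (iteratedDeriv k F (d : ℂ)).re := by
  have hopen : IsOpen {z : ℂ | z.re < r} := isOpen_lt Complex.continuous_re continuous_const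
  induction k generalizing d with
  | zero => simp
  | succ k ih =>
    rw [iteratedDeriv_succ, iteratedDeriv_succ]
    have h1 : iteratedDeriv k (fun y : ℝ => (F y).re) =ᶠ[𝓝 d]
        fun y : ℝ => (iteratedDeriv k F (y : ℂ)).re := by
      filter_upwards [isOpen_Iio.mem_nhds hd] with y hy using ih hy
    rw [h1.deriv_eq]
    have hk : DifferentiableAt ℂ (iteratedDeriv k F) (d : ℂ) := by
      rw [iteratedDeriv_eq_iterate]
      exact ((hF.analyticAt (hopen.mem_nhds (by simpa using hd))).iterated_deriv k).differentiableAt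
    exact hk.hasDerivAt.real_of_complex.deriv

/-- If the partial sums of `x` grow at most like `n ^ γ`, then `∑ x_j j ^ (d - 1)` defines a smooth
function of `d < 1 - γ`, which can be differentiated term by term. -/
lemma exists_contDiffOn_dirichlet {x : ℕ → ℝ} {γ K : ℝ} (hγ : 0 ≤ γ)
    (hx : ∀ n : ℕ, |∑ j ∈ Finset.Icc 1 n, x j| ≤ K * (n : ℝ) ^ γ) :
    ∃ H : ℝ → ℝ, ContDiffOn ℝ ((⊤ : ℕ∞) : WithTop ℕ∞) H (Set.Iio (1 - γ)) ∧
      ∀ k : ℕ, ∀ d < 1 - γ, Tendsto (fun n : ℕ => iteratedDeriv k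
        (fun y : ℝ => ∑ j ∈ Finset.Icc 1 n, x j * (j : ℝ) ^ (y - 1)) d) atTop
        (𝓝 (iteratedDeriv k H d)) := by
  obtain ⟨F, hF⟩ := exists_tendstoLocallyUniformlyOn_dirichlet hγ hx
  have hopen : IsOpen {z : ℂ | z.re < 1 - γ} := isOpen_lt Complex.continuous_re continuous_const
  set S : ℕ → ℂ → ℂ := fun n z => ∑ j ∈ Finset.Icc 1 n, (x j : ℂ) * (j : ℂ) ^ (z - 1) with hS
  have hSd : ∀ n, Differentiable ℂ (S n) := by
    intro n z
    refine DifferentiableAt.fun_sum fun j hj => ?_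
    have hj0 : (j : ℂ) ≠ 0 := by
      have := (Finset.mem_Icc.1 hj).1
      exact_mod_cast (by omega : j ≠ 0)
    exact ((differentiableAt_id.sub_const 1).const_cpow (Or.inl hj0)).const_mul _
  have hFd : DifferentiableOn ℂ F {z | z.re < 1 - γ} :=
    hF.differentiableOn (Eventually.of_forall fun n => (hSd n).differentiableOn) hopen
  -- Complex differentiability pays off here: locally uniform convergence of holomorphic functions
  -- passes to their derivatives.
  have hconv : ∀ k, TendstoLocallyUniformlyOn (fun n => iteratedDeriv k (S n)) (iteratedDeriv k F)
      atTop {z | z.re < 1 - γ} := by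
    intro k
    induction k with
    | zero => simpa only [iteratedDeriv_zero] using hF
    | succ k ih =>
      have h := ih.deriv (Eventually.of_forall fun n => ?_) hopen
      · rw [iteratedDeriv_succ]
        refine h.congr fun n z _ => ?_
        simp [iteratedDeriv_succ]
      · have hc : ContDiff ℂ ⊤ (S n) := (hSd n).contDiff
        exact (hc.differentiable_iteratedDeriv k
          (by exact WithTop.coe_lt_top _)).differentiableOn
  refine ⟨fun y => (F y).re, ?_, fun k d hd => ?_⟩
  · have h1 : ContDiffOn ℝ ((⊤ : ℕ∞) : WithTop ℕ∞) F {z | z.re < 1 - γ} :=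
      (hFd.contDiffOn hopen).restrict_scalars ℝ
    exact Complex.reCLM.contDiff.comp_contDiffOn
      (h1.comp Complex.ofRealCLM.contDiff.contDiffOn fun y hy => by simpa using hy)
  · rw [iteratedDeriv_re_comp_ofReal hFd k hd]
    have h1 : ∀ n, iteratedDeriv k
        (fun y : ℝ => ∑ j ∈ Finset.Icc 1 n, x j * (j : ℝ) ^ (y - 1)) d =
          (iteratedDeriv k (S n) (d : ℂ)).re := by
      intro n
      rw [← iteratedDeriv_re_comp_ofReal (r := 1 - γ) (hSd n).differentiableOn k hd]
      congr 1
      funext y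
      rw [hS]
      simp only [Complex.re_sum]
      refine Finset.sum_congr rfl fun j hj => ?_
      rw [Complex.re_ofReal_mul]
      congr 1
      have : ((j : ℂ) ^ ((y : ℂ) - 1)) = (((j : ℝ) ^ (y - 1) : ℝ) : ℂ) := by
        rw [Complex.ofReal_cpow (by positivity)]
        simp
      rw [this, Complex.ofReal_re]
    simp only [h1]
    exact (Complex.continuous_re.tendsto _).comp ((hconv k).tendsto_at (by simpa using hd))

/-! ### A maximal inequality by dyadic blocks -/

section MaximalInequality

/-- The sum of `y` over the dyadic block of length `2 ^ i` with index `k`. -/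
def dyadicBlock (y : ℕ → ℝ) (i k : ℕ) : ℝ :=
  ∑ j ∈ Finset.Ico (2 ^ i * k) (2 ^ i * (k + 1)), y j

/-- The sum of the squares of the dyadic block sums below `2 ^ m`. -/
def dyadicEnergy (y : ℕ → ℝ) (m : ℕ) : ℝ :=
  ∑ i ∈ Finset.range m, ∑ k ∈ Finset.range (2 ^ (m - i)), dyadicBlock y i k ^ 2

lemma dyadicEnergy_nonneg (y : ℕ → ℝ) (m : ℕ) : 0 ≤ dyadicEnergy y m :=
  Finset.sum_nonneg fun _ _ => Finset.sum_nonneg fun _ _ => sq_nonneg _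

lemma abs_dyadicBlock_le {y : ℕ → ℝ} {m i k : ℕ} (hi : i < m) (hk : k < 2 ^ (m - i)) :
    |dyadicBlock y i k| ≤ √(dyadicEnergy y m) := by
  refine Real.abs_le_sqrt ?_
  calc dyadicBlock y i k ^ 2
      ≤ ∑ k ∈ Finset.range (2 ^ (m - i)), dyadicBlock y i k ^ 2 :=
        Finset.single_le_sum (f := fun k => dyadicBlock y i k ^ 2)
          (fun _ _ => sq_nonneg _) (Finset.mem_range.2 hk)
    _ ≤ dyadicEnergy y m :=
        Finset.single_le_sum (f := fun i => ∑ k ∈ Finset.range (2 ^ (m - i)), dyadicBlock y i k ^ 2)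
          (fun _ _ => Finset.sum_nonneg fun _ _ => sq_nonneg _) (Finset.mem_range.2 hi)

/-- The binary expansion of `n` splits `[0, n)` into at most one dyadic block per level `i < m`, and
each block sum is at most the root of the energy. The induction rounds `n` down to multiples of `2 ^
i`. -/
lemma abs_sum_range_le_of_lt_two_pow (y : ℕ → ℝ) {m n : ℕ} (hn : n < 2 ^ m) :
    |∑ j ∈ Finset.range n, y j| ≤ m * √(dyadicEnergy y m) := by
  have key : ∀ i ≤ m, |∑ j ∈ Finset.range n, y j -
      ∑ j ∈ Finset.range (2 ^ i * (n / 2 ^ i)), y j| ≤ i * √(dyadicEnergy y m) := by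
    intro i
    induction i with
    | zero => simp
    | succ i ih =>
      intro hi
      have h1 := ih (by omega)
      suffices h2 : |∑ j ∈ Finset.range (2 ^ i * (n / 2 ^ i)), y j -
          ∑ j ∈ Finset.range (2 ^ (i + 1) * (n / 2 ^ (i + 1))), y j| ≤ √(dyadicEnergy y m) by
        have h3 := abs_sub_le (∑ j ∈ Finset.range n, y j)
          (∑ j ∈ Finset.range (2 ^ i * (n / 2 ^ i)), y j)
          (∑ j ∈ Finset.range (2 ^ (i + 1) * (n / 2 ^ (i + 1))), y j)
        push_cast
        linarith
      set q := n / 2 ^ i with hq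
      have hq2 : n / 2 ^ (i + 1) = q / 2 := by rw [hq, pow_succ, Nat.div_div_eq_div_mul]
      have hqlt : q < 2 ^ (m - i) := by
        rw [hq, Nat.div_lt_iff_lt_mul (by positivity), ← pow_add, Nat.sub_add_cancel (by omega)]
        exact hn
      rw [hq2, pow_succ, mul_assoc]
      -- For even `q` the two roundings coincide; for `q = 2 * k + 1` they differ by the block of
      -- index `2 * k` at level `i`.
      rcases Nat.even_or_odd' q with ⟨k, hk | hk⟩
      · rw [show 2 * (q / 2) = q by omega]
        simp
      · rw [show 2 * (q / 2) = 2 * k by omega, hk,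
          ← Finset.sum_Ico_eq_sub _ (Nat.mul_le_mul_left _ (by omega))]
        exact abs_dyadicBlock_le (by omega) (by omega)
  have := key m le_rfl
  rwa [Nat.div_eq_of_lt hn, mul_zero, Finset.range_zero, Finset.sum_empty, sub_zero] at this

variable {Ω : Type*} [MeasurableSpace Ω] {P : Measure Ω}

lemma integral_sum_mul_sq {Y : ℕ → Ω → ℝ} {v : ℝ} (hY : ∀ j, MemLp (Y j) 2 P)
    (horth : ∀ i j, i ≠ j → ∫ ω, Y i ω * Y j ω ∂P = 0)
    (hv : ∀ j, ∫ ω, Y j ω ^ 2 ∂P = v) (b : ℕ → ℝ) (s : Finset ℕ) :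
    ∫ ω, (∑ j ∈ s, b j * Y j ω) ^ 2 ∂P = v * ∑ j ∈ s, b j ^ 2 := by
  have hint : ∀ i j, Integrable (fun ω => (b i * Y i ω) * (b j * Y j ω)) P := fun i j => by
    have h := ((hY i).const_mul (b i)).integrable_mul ((hY j).const_mul (b j))
    exact h
  simp only [sq (∑ j ∈ s, _), Finset.sum_mul_sum]
  rw [integral_finsetSum _ fun i _ => integrable_finsetSum _ fun j _ => hint i j,
    Finset.mul_sum]
  refine Finset.sum_congr rfl fun i hi => ?_
  rw [integral_finsetSum _ fun j _ => hint i j, Finset.sum_eq_single_of_mem i hi]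
  · rw [← hv i, mul_comm, ← integral_const_mul]
    exact integral_congr_ae (Eventually.of_forall fun ω => by ring)
  · intro j _ hji
    have : (fun ω => (b i * Y i ω) * (b j * Y j ω)) = fun ω => (b i * b j) * (Y i ω * Y j ω) := by
      funext ω; ring
    rw [this, integral_const_mul, horth i j hji.symm, mul_zero]

/-- Level `i` has `2 ^ (m - i)` blocks of mean square `2 ^ i * v`, so each of the `m` levels
contributes `2 ^ m * v`. -/
lemma integral_dyadicEnergy {Y : ℕ → Ω → ℝ} {v : ℝ} (hY : ∀ j, MemLp (Y j) 2 P)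
    (horth : ∀ i j, i ≠ j → ∫ ω, Y i ω * Y j ω ∂P = 0)
    (hv : ∀ j, ∫ ω, Y j ω ^ 2 ∂P = v) (m : ℕ) :
    Integrable (fun ω => dyadicEnergy (fun j => Y j ω) m) P ∧
      ∫ ω, dyadicEnergy (fun j => Y j ω) m ∂P = m * 2 ^ m * v := by
  have hint : ∀ i k, Integrable (fun ω => dyadicBlock (fun j => Y j ω) i k ^ 2) P := fun i k =>
    (memLp_finsetSum _ fun j _ => hY j).integrable_sq
  have hval : ∀ i k, ∫ ω, dyadicBlock (fun j => Y j ω) i k ^ 2 ∂P = 2 ^ i * v := fun i k => by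
    have h := integral_sum_mul_sq hY horth hv (fun _ => 1)
      (Finset.Ico (2 ^ i * k) (2 ^ i * (k + 1)))
    simp only [one_mul, one_pow, Finset.sum_const, Nat.card_Ico, nsmul_eq_mul, mul_one] at h
    simp only [dyadicBlock]
    rw [h, ← Nat.mul_sub, Nat.add_sub_cancel_left]
    push_cast
    ring
  refine ⟨integrable_finsetSum _ fun i _ => integrable_finsetSum _ fun k _ => hint i k, ?_⟩
  unfold dyadicEnergy
  rw [integral_finsetSum _ fun i _ => integrable_finsetSum _ fun k _ => hint i k]
  have : ∀ i ∈ Finset.range m, ∫ ω, ∑ k ∈ Finset.range (2 ^ (m - i)),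
      dyadicBlock (fun j => Y j ω) i k ^ 2 ∂P = 2 ^ m * v := by
    intro i hi
    rw [integral_finsetSum _ fun k _ => hint i k]
    simp only [hval, Finset.sum_const, Finset.card_range, nsmul_eq_mul]
    push_cast
    rw [← mul_assoc, ← pow_add, Nat.sub_add_cancel (Finset.mem_range.1 hi).le]
  rw [Finset.sum_congr rfl this]
  simp [mul_assoc]

/-- Nonnegative random variables with summable expectations are almost surely bounded. -/
lemma ae_exists_forall_le_of_summable_integral {Z : ℕ → Ω → ℝ} (hZ : ∀ m, Integrable (Z m) P)
    (hZ0 : ∀ m ω, 0 ≤ Z m ω) (hs : Summable fun m => ∫ ω, Z m ω ∂P) :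
    ∀ᵐ ω ∂P, ∃ K : ℝ, ∀ m, Z m ω ≤ K := by
  have hmeas : ∀ m, AEMeasurable (fun ω => ENNReal.ofReal (Z m ω)) P := fun m =>
    (hZ m).aestronglyMeasurable.aemeasurable.ennreal_ofReal
  have hfin : ∫⁻ ω, ∑' m, ENNReal.ofReal (Z m ω) ∂P ≠ ⊤ := by
    rw [lintegral_tsum hmeas]
    have : ∀ m, ∫⁻ ω, ENNReal.ofReal (Z m ω) ∂P = ENNReal.ofReal (∫ ω, Z m ω ∂P) := fun m =>
      (ofReal_integral_eq_lintegral_ofReal (hZ m) (Eventually.of_forall (hZ0 m))).symm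
    simp only [this]
    exact hs.tsum_ofReal_ne_top
  filter_upwards [ae_lt_top' (AEMeasurable.tsum hmeas) hfin] with ω hω
  refine ⟨(∑' m, ENNReal.ofReal (Z m ω)).toReal, fun m => ?_⟩
  rw [← ENNReal.ofReal_le_iff_le_toReal hω.ne]
  exact ENNReal.le_tsum m

/-- The partial sums of an orthogonal sequence with constant second moment are almost surely
`O(n ^ γ)`, for every `γ > 1 / 2`. -/
lemma ae_exists_abs_sum_range_le_rpow {Y : ℕ → Ω → ℝ} {v : ℝ} (hY : ∀ j, MemLp (Y j) 2 P)
    (horth : ∀ i j, i ≠ j → ∫ ω, Y i ω * Y j ω ∂P = 0)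
    (hv : ∀ j, ∫ ω, Y j ω ^ 2 ∂P = v) {γ : ℝ} (hγ : 1 / 2 < γ) :
    ∀ᵐ ω ∂P, ∃ K : ℝ, ∀ n : ℕ, |∑ j ∈ Finset.range n, Y j ω| ≤ K * (n : ℝ) ^ γ := by
  set r : ℝ := ((2 : ℝ) ^ (2 * γ))⁻¹ with hr
  have hr0 : 0 < r := by positivity
  have hr2 : 2 * r < 1 := by
    rw [hr, ← div_eq_mul_inv, div_lt_one (by positivity)]
    calc (2 : ℝ) = 2 ^ (1 : ℝ) := by simp
      _ < 2 ^ (2 * γ) := Real.rpow_lt_rpow_of_exponent_lt (by norm_num) (by linarith)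
  -- The weight `m ^ 2` absorbs the squared factor `m` of the maximal bound. The expectations are `v
  -- * m ^ 3 * (2 * r) ^ m`, summable because `γ > 1 / 2` gives `2 * r < 1`.
  have hbd := ae_exists_forall_le_of_summable_integral (P := P)
    (Z := fun m ω => (m ^ 2 * r ^ m) * dyadicEnergy (fun j => Y j ω) m)
    (fun m => (integral_dyadicEnergy hY horth hv m).1.const_mul _)
    (fun m ω => mul_nonneg (by positivity) (dyadicEnergy_nonneg _ _)) (by
      have h := (summable_pow_mul_geometric_of_norm_lt_one (R := ℝ) 3 (r := 2 * r)
        (by rwa [Real.norm_of_nonneg (by positivity)])).mul_left v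
      refine h.congr fun m => ?_
      rw [integral_const_mul, (integral_dyadicEnergy hY horth hv m).2, mul_pow]
      ring)
  filter_upwards [hbd] with ω ⟨K, hK⟩
  have hK0 : 0 ≤ K := by simpa using hK 0
  refine ⟨√K * 2 ^ γ, fun n => ?_⟩
  rcases Nat.eq_zero_or_pos n with rfl | hn
  · simp
    positivity
  set m := Nat.log 2 n + 1 with hm
  have hlt : n < 2 ^ m := Nat.lt_pow_succ_log_self (by norm_num) n
  have hle : 2 ^ m ≤ 2 * n := by
    rw [hm, pow_succ, mul_comm]
    exact Nat.mul_le_mul_left 2 (Nat.pow_log_le_self 2 hn.ne')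
  refine (abs_sum_range_le_of_lt_two_pow _ hlt).trans ?_
  set E := dyadicEnergy (fun j => Y j ω) m
  have hE : (m : ℝ) ^ 2 * E ≤ K * (r ^ m)⁻¹ := by
    rw [← div_eq_mul_inv, le_div_iff₀ (by positivity)]
    calc (m : ℝ) ^ 2 * E * r ^ m = m ^ 2 * r ^ m * E := by ring
      _ ≤ K := hK m
  calc (m : ℝ) * √E = √(m ^ 2 * E) := by
        rw [Real.sqrt_mul (by positivity), Real.sqrt_sq (by positivity)]
    _ ≤ √(K * (r ^ m)⁻¹) := Real.sqrt_le_sqrt hE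
    _ = √K * ((2 : ℝ) ^ m) ^ γ := by
        rw [Real.sqrt_mul hK0]
        congr 1
        rw [hr, inv_pow, inv_inv, Real.sqrt_eq_rpow, ← Real.rpow_natCast, ← Real.rpow_natCast,
          ← Real.rpow_mul (by positivity), ← Real.rpow_mul (by positivity),
          ← Real.rpow_mul (by positivity)]
        congr 1
        ring
    _ ≤ √K * (2 * n) ^ γ := by
        gcongr
        exact_mod_cast hle
    _ = √K * 2 ^ γ * (n : ℝ) ^ γ := by
        rw [Real.mul_rpow (by norm_num) (by positivity), mul_assoc]

end MaximalInequality

/-! ### Orthogonality of the observations -/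

section Covariance

lemma sum_Icc_one_eq_sum_range {M : Type*} [AddCommMonoid M] (f : ℕ → M) (n : ℕ) :
    ∑ j ∈ Finset.Icc 1 n, f j = ∑ j ∈ Finset.range n, f (j + 1) := by
  rw [Finset.range_eq_Ico, Finset.sum_Ico_add' f 0 n 1]
  rfl

variable {Ω : Type*} [MeasurableSpace Ω] {P : Measure Ω}

lemma IsStationaryLARCH.integral_sq_eq {ε X s : ℤ → Ω → ℝ} {a : ℝ} {b : ℕ → ℝ}
    (hX : IsStationaryLARCH P ε a b X s) (t : ℤ) :
    ∫ ω, X t ω ^ 2 ∂P = ∫ ω, X 0 ω ^ 2 ∂P := by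
  have h := ((hX.stationary t).comp (u := fun x : ℤ → ℝ × ℝ => (x 0).1 ^ 2)
    (by fun_prop)).integral_eq
  simpa [Function.comp_def] using h.symm

/-- The volatility is almost surely a measurable function of the past observations. -/
lemma IsVolatilitySum.exists_measurable_past {X : ℤ → Ω → ℝ} {a : ℝ} {b : ℕ → ℝ} {t : ℤ}
    {Y : Ω → ℝ} (h : IsVolatilitySum P X a b t Y) :
    ∃ g : (Set.Iio t → ℝ) → ℝ, Measurable g ∧ Y =ᵐ[P] fun ω => g fun u => X u ω := by
  obtain ⟨ns, -, hns⟩ := h.exists_seq_tendsto_ae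
  let G : ℕ → (Set.Iio t → ℝ) → ℝ := fun n x =>
    a + ∑ j ∈ Finset.range n, b (j + 1) * x ⟨t - ((j + 1 : ℕ) : ℤ), by simp⟩
  have hG : ∀ n, Measurable (G n) := fun n => by
    refine measurable_const.add (Finset.measurable_sum _ fun j _ => ?_)
    exact (measurable_pi_apply _).const_mul _
  -- The limsup is measurable whether or not the sums converge, and is their limit along almost
  -- every path.
  refine ⟨fun x => limsup (fun i => G (ns i) x) atTop, Measurable.limsup fun i => hG _, ?_⟩
  filter_upwards [hns] with ω hω
  refine Eq.symm (Tendsto.limsup_eq ?_)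
  refine hω.congr fun i => ?_
  simp only [G, sum_Icc_one_eq_sum_range]

/-- The product is `ε_t` times `X_u σ_t`, and the latter is a function of the past; independence
splits off `E(ε_t) = 0`. -/
lemma IsStationaryLARCH.integral_mul_eq_zero_of_lt {ε X s : ℤ → Ω → ℝ} {a : ℝ} {b : ℕ → ℝ}
    (hε : IsInnovation P ε) (hX : IsStationaryLARCH P ε a b X s) {u t : ℤ} (hut : u < t) :
    ∫ ω, X u ω * X t ω ∂P = 0 := by
  obtain ⟨g, hg, hgs⟩ := (hX.volatility t).exists_measurable_past
  have hψ : Measurable fun x : Set.Iio t → ℝ => x ⟨u, hut⟩ * g x :=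
    (measurable_pi_apply _).mul hg
  have hind := (hX.nonanticipative t).comp measurable_id hψ
  have hpast : Measurable fun ω => fun u : Set.Iio t => X u ω :=
    measurable_pi_lambda _ fun u => hX.measurable_X u
  have h := hind.integral_mul_eq_mul_integral (hε.measurable t).aestronglyMeasurable
    (hψ.comp hpast).aestronglyMeasurable
  rw [show ∫ ω, (id ∘ ε t) ω ∂P = 0 from hε.mean t, zero_mul] at h
  rw [← h]
  refine integral_congr_ae ?_
  filter_upwards [hX.observation t, hgs] with ω h1 h2
  simp only [h1, h2, Pi.mul_apply, Function.comp_apply, id]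
  ring

lemma IsStationaryLARCH.integral_mul_eq_zero {ε X s : ℤ → Ω → ℝ} {a : ℝ} {b : ℕ → ℝ}
    (hε : IsInnovation P ε) (hX : IsStationaryLARCH P ε a b X s) {u t : ℤ} (hut : u ≠ t) :
    ∫ ω, X u ω * X t ω ∂P = 0 := by
  rcases hut.lt_or_gt with h | h
  · exact hX.integral_mul_eq_zero_of_lt hε h
  · simpa only [mul_comm] using hX.integral_mul_eq_zero_of_lt hε h

/-- The backward partial sums of the observations are almost surely `O(n ^ γ)`, `γ > 1 / 2`. -/
lemma IsStationaryLARCH.ae_exists_abs_sum_le_rpow {ε X s : ℤ → Ω → ℝ} {a : ℝ} {b : ℕ → ℝ}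
    (hε : IsInnovation P ε) (hX : IsStationaryLARCH P ε a b X s) (t : ℤ) {γ : ℝ}
    (hγ : 1 / 2 < γ) :
    ∀ᵐ ω ∂P, ∃ K : ℝ, ∀ n : ℕ, |∑ j ∈ Finset.Icc 1 n, X (t - (j : ℤ)) ω| ≤ K * (n : ℝ) ^ γ := by
  simp only [sum_Icc_one_eq_sum_range]
  exact ae_exists_abs_sum_range_le_rpow (Y := fun j => X (t - ((j + 1 : ℕ) : ℤ)))
    (fun j => hX.memLp_X _) (fun i j hij => hX.integral_mul_eq_zero hε (by simpa using hij))
    (fun j => hX.integral_sq_eq _) hγ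

end Covariance

/-! ### From rational points to all parameters -/

section Separability

variable {Ω : Type*} [MeasurableSpace Ω] {P : Measure Ω}

/-- A separable process which agrees with a process with continuous paths at the rational points
is almost surely equal to it. -/
lemma IsSeparableProcess.ae_eqOn {Θ : Set (ℝ × ℝ × ℝ)} {ξ : ℝ × ℝ × ℝ → Ω → ℝ}
    (hξ : IsSeparableProcess P Θ ξ) {G : ℝ × ℝ × ℝ → Ω → ℝ}
    (hG : ∀ᵐ ω ∂P, ContinuousOn (fun θ => G θ ω) Θ)
    (heq : ∀ θ ∈ Θ ∩ rationalPoints, ξ θ =ᵐ[P] G θ) :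
    ∀ᵐ ω ∂P, Set.EqOn (fun θ => ξ θ ω) (fun θ => G θ ω) Θ := by
  have hcount : (Θ ∩ rationalPoints).Countable :=
    (Set.countable_range _).mono Set.inter_subset_right
  have h1 : ∀ᵐ ω ∂P, ∀ θ ∈ Θ ∩ rationalPoints, ξ θ ω = G θ ω :=
    (ae_ball_iff hcount).2 fun θ hθ => heq θ hθ
  -- Basic open sets and rational intervals suffice, so only countably many null sets are discarded.
  have h2 : ∀ᵐ ω ∂P, ∀ U ∈ TopologicalSpace.countableBasis (ℝ × ℝ × ℝ), ∀ x y : ℚ, (x : ℝ) ≤ y →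
      (∀ θ ∈ U ∩ Θ ∩ rationalPoints, ξ θ ω ∈ Set.Icc (x : ℝ) y) →
        ∀ θ ∈ U ∩ Θ, ξ θ ω ∈ Set.Icc (x : ℝ) y := by
    refine (ae_ball_iff (TopologicalSpace.countable_countableBasis _)).2 fun U hU => ?_
    refine ae_all_iff.2 fun x => ae_all_iff.2 fun y => ?_
    by_cases hxy : (x : ℝ) ≤ y
    · filter_upwards [hξ U (TopologicalSpace.isOpen_of_mem_countableBasis hU) x y hxy] with ω hω
      exact fun _ => hω.2
    · exact Eventually.of_forall fun ω h => absurd h hxy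
  filter_upwards [hG, h1, h2] with ω hGω h1ω h2ω θ hθ
  -- By continuity `G` stays in `[x, y]` near `θ`, hence so does `ξ` at the nearby rational points,
  -- and by separability at `θ` itself.
  have key : ∀ x y : ℚ, (x : ℝ) < G θ ω → G θ ω < y → ξ θ ω ∈ Set.Icc (x : ℝ) y := by
    intro x y hx hy
    have hmem : {θ' | G θ' ω ∈ Set.Ioo (x : ℝ) y} ∈ 𝓝[Θ] θ := hGω θ hθ (Ioo_mem_nhds hx hy)
    obtain ⟨V, hV, hVΘ⟩ := mem_nhdsWithin_iff_exists_mem_nhds_inter.1 hmem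
    obtain ⟨U, hU, hθU, hUV⟩ :=
      (TopologicalSpace.isBasis_countableBasis (ℝ × ℝ × ℝ)).mem_nhds_iff.1 hV
    refine h2ω U hU x y (hx.trans hy).le (fun θ' hθ' => ?_) θ ⟨hθU, hθ⟩
    rw [h1ω θ' ⟨hθ'.1.2, hθ'.2⟩]
    exact Set.Ioo_subset_Icc_self (hVΘ ⟨hUV hθ'.1.1, hθ'.1.2⟩)
  refine le_antisymm ?_ ?_
  · refine le_of_forall_gt fun z hz => ?_
    obtain ⟨y, hy, hyz⟩ := exists_rat_btwn hz
    obtain ⟨x, hx⟩ := exists_rat_lt (G θ ω)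
    exact (key x y hx hy).2.trans_lt hyz
  · refine le_of_forall_lt fun z hz => ?_
    obtain ⟨x, hzx, hx⟩ := exists_rat_btwn hz
    obtain ⟨y, hy⟩ := exists_rat_gt (G θ ω)
    exact hzx.trans_le (key x y hx hy).1

end Separability

/-! ### Sections of the parameter set -/

section ParameterSet

/-- Every term of the sum increases with `d`, and the power `-1/2` reverses this. The bound `d < 1 /
2` matters: a divergent `tsum` would be 0. -/
lemma cUpper_antitoneOn {C : ℝ} (hC : 0 ≤ C) : AntitoneOn (cUpper C) (Set.Iio (1 / 2)) := by
  have hsum : ∀ d : ℝ, d < 1 / 2 → Summable fun j : ℕ => ((j : ℝ) + 1) ^ (2 * d - 2) := by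
    intro d hd
    have h := (summable_nat_add_iff 1).2 (Real.summable_nat_rpow.2 (by linarith : 2 * d - 2 < -1))
    simpa using h
  intro d hd e he hde
  have hpos : 0 < ∑' j : ℕ, ((j : ℝ) + 1) ^ (2 * d - 2) :=
    (hsum d hd).tsum_pos (fun j => by positivity) 0 (by positivity)
  refine mul_le_mul_of_nonneg_left (Real.rpow_le_rpow_of_nonpos hpos ?_ (by norm_num)) hC
  refine (hsum d hd).tsum_le_tsum (fun j => ?_) (hsum e he)
  exact Real.rpow_le_rpow_of_exponent_le (by simp) (by linarith)

/-- As `c_u` decreases, `c ≤ c_u(y)` persists for smaller `d`, so the section is an interval; with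
two points it has interior. -/
lemma uniqueDiffOn_dSection {C d_u a_d a_u : ℝ} (hC : 0 ≤ C) (hdu : d_u < 1 / 2) {c a : ℝ}
    (h : (dSection (paramSet C d_u a_d a_u) c a).Nontrivial) :
    UniqueDiffOn ℝ (dSection (paramSet C d_u a_d a_u) c a) := by
  have hord : (dSection (paramSet C d_u a_d a_u) c a).OrdConnected := by
    refine ⟨fun x hx y hy z hz => ?_⟩
    obtain ⟨hx1, hx2, hx3⟩ := hx
    obtain ⟨hy1, hy2, -⟩ := hy
    refine ⟨⟨hx1.1.trans hz.1, hz.2.trans hy1.2⟩, ⟨hx2.1, hy2.2.trans ?_⟩, hx3⟩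
    exact cUpper_antitoneOn hC (lt_of_le_of_lt (hz.2.trans hy1.2) hdu) (lt_of_le_of_lt hy1.2 hdu)
      hz.2
  refine uniqueDiffOn_convex hord.convex ?_
  obtain ⟨x, hx, y, hy, hxy⟩ := h.exists_lt
  obtain ⟨z, hz⟩ := exists_between hxy
  exact ⟨z, mem_interior.2 ⟨Set.Ioo x y, Set.Ioo_subset_Icc_self.trans (hord.out hx hy), isOpen_Ioo,
    hz⟩⟩

end ParameterSet

/-! ### Derivatives of the coefficients -/

section Coefficients

lemma contDiff_coef (c : ℝ) {j : ℕ} (hj : 0 < j) {n : WithTop ℕ∞} :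
    ContDiff ℝ n fun d => coef c d j := by
  have hj' : (0 : ℝ) < j := by exact_mod_cast hj
  simp only [coef, Real.rpow_def_of_pos hj']
  fun_prop

lemma iteratedDeriv_coef (c : ℝ) {j : ℕ} (hj : 0 < j) (k : ℕ) (d : ℝ) :
    iteratedDeriv k (fun d' => coef c d' j) d = c * Real.log j ^ k * (j : ℝ) ^ (d - 1) := by
  have hj' : (0 : ℝ) < j := by exact_mod_cast hj
  induction k generalizing d with
  | zero => simp [coef]
  | succ k ih =>
    rw [iteratedDeriv_succ, funext ih]
    have h := ((hasDerivAt_id' d).sub_const 1).const_rpow hj'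
    rw [(h.const_mul (c * Real.log j ^ k)).deriv]
    ring

lemma summable_iteratedDeriv_coef_sq (c : ℝ) (k : ℕ) {d : ℝ} (hd : d < 1 / 2) :
    Summable fun j : ℕ => iteratedDeriv k (fun d' => coef c d' (j + 1)) d ^ 2 := by
  -- With `log y ≤ y ^ δ / δ`, the logarithms cost `y ^ (2 * k * δ)`; this `δ` makes `2 * k * δ < 1
  -- - 2 * d`.
  set δ : ℝ := (1 - 2 * d) / (4 * (k + 1)) with hδ
  have hδ0 : 0 < δ := by have : 0 < 1 - 2 * d := by linarith
                         positivity
  have hexp : δ * (2 * k) + (2 * d - 2) < -1 := by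
    have h1 : δ * (4 * (k + 1)) = 1 - 2 * d := by rw [hδ]; field_simp
    nlinarith
  have hs := ((summable_nat_add_iff 1).2 (Real.summable_nat_rpow.2 hexp)).mul_left
    (c ^ 2 * (1 / δ) ^ (2 * k))
  refine hs.of_nonneg_of_le (fun j => sq_nonneg _) fun j => ?_
  rw [iteratedDeriv_coef c j.succ_pos]
  set y : ℝ := ((j + 1 : ℕ) : ℝ) with hy
  have hy1 : 1 ≤ y := by simp [hy]
  have hy0 : 0 < y := by linarith
  have hlog : Real.log y ^ (2 * k) ≤ (1 / δ) ^ (2 * k) * y ^ (δ * (2 * k)) := by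
    calc Real.log y ^ (2 * k) ≤ (y ^ δ / δ) ^ (2 * k) :=
          pow_le_pow_left₀ (Real.log_nonneg hy1) (Real.log_le_rpow_div hy0.le hδ0) _
      _ = (1 / δ) ^ (2 * k) * y ^ (δ * (2 * k)) := by
          rw [Real.rpow_mul hy0.le, div_eq_mul_one_div, mul_pow, mul_comm]
          congr 1
          exact_mod_cast (Real.rpow_natCast (y ^ δ) (2 * k)).symm
  calc (c * Real.log y ^ k * y ^ (d - 1)) ^ 2
      = c ^ 2 * Real.log y ^ (2 * k) * y ^ (2 * d - 2) := by
        rw [show 2 * d - 2 = (d - 1) * (2 : ℕ) by push_cast; ring, Real.rpow_mul hy0.le,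
          Real.rpow_natCast]
        ring
    _ ≤ c ^ 2 * ((1 / δ) ^ (2 * k) * y ^ (δ * (2 * k))) * y ^ (2 * d - 2) := by gcongr
    _ = c ^ 2 * (1 / δ) ^ (2 * k) * y ^ (δ * (2 * k) + (2 * d - 2)) := by
        rw [Real.rpow_add hy0]
        ring

end Coefficients

/-! ### Mean square convergence of orthogonal series -/

section MeanSquare

variable {Ω : Type*} [MeasurableSpace Ω] {P : Measure Ω}

lemma eLpNorm_two_sum_eq {Y : ℕ → Ω → ℝ} {v : ℝ} (hY : ∀ j, MemLp (Y j) 2 P)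
    (horth : ∀ i j, i ≠ j → ∫ ω, Y i ω * Y j ω ∂P = 0)
    (hv : ∀ j, ∫ ω, Y j ω ^ 2 ∂P = v) (b : ℕ → ℝ) (s : Finset ℕ) :
    eLpNorm (fun ω => ∑ j ∈ s, b j * Y j ω) 2 P = ENNReal.ofReal √(v * ∑ j ∈ s, b j ^ 2) := by
  have hmem : MemLp (fun ω => ∑ j ∈ s, b j * Y j ω) 2 P :=
    memLp_finsetSum _ fun j _ => (hY j).const_mul _
  rw [hmem.eLpNorm_eq_integral_rpow_norm (by norm_num) (by norm_num),
    ← integral_sum_mul_sq hY horth hv, Real.sqrt_eq_rpow]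
  norm_num

/-- An orthogonal series with square summable coefficients which converges almost surely also
converges in mean square, to the same limit. -/
lemma tendsto_eLpNorm_sum_sub {Y : ℕ → Ω → ℝ} {v : ℝ} (hY : ∀ j, MemLp (Y j) 2 P)
    (horth : ∀ i j, i ≠ j → ∫ ω, Y i ω * Y j ω ∂P = 0)
    (hv : ∀ j, ∫ ω, Y j ω ^ 2 ∂P = v) {b : ℕ → ℝ} (hb : Summable fun j => b j ^ 2) {Z : Ω → ℝ}
    (hZ : ∀ᵐ ω ∂P, Tendsto (fun n => ∑ j ∈ Finset.range n, b j * Y j ω) atTop (𝓝 (Z ω))) :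
    Tendsto (fun n => eLpNorm (fun ω => ∑ j ∈ Finset.range n, b j * Y j ω - Z ω) 2 P) atTop
      (𝓝 0) := by
  have hv0 : 0 ≤ v := hv 0 ▸ integral_nonneg fun ω => sq_nonneg _
  have hbound : ∀ n, eLpNorm (fun ω => ∑ j ∈ Finset.range n, b j * Y j ω - Z ω) 2 P ≤
      ENNReal.ofReal √(v * ∑' j, b (j + n) ^ 2) := by
    intro n
    have hle : ∀ m ≥ n, eLpNorm (fun ω => ∑ j ∈ Finset.range n, b j * Y j ω -
        ∑ j ∈ Finset.range m, b j * Y j ω) 2 P ≤ ENNReal.ofReal √(v * ∑' j, b (j + n) ^ 2) := by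
      intro m hm
      have h1 : (fun ω => ∑ j ∈ Finset.range n, b j * Y j ω -
          ∑ j ∈ Finset.range m, b j * Y j ω) =
          -fun ω => ∑ j ∈ Finset.Ico n m, b j * Y j ω := by
        funext ω
        rw [Pi.neg_apply, Finset.sum_Ico_eq_sub _ hm, neg_sub]
      rw [h1, eLpNorm_neg, eLpNorm_two_sum_eq hY horth hv]
      gcongr
      rw [Finset.sum_Ico_eq_sum_range]
      simp only [add_comm n]
      exact ((summable_nat_add_iff n).2 hb).sum_le_tsum _ fun _ _ => sq_nonneg _
    -- Fatou as `m → ∞`: the tail bound is uniform in `m`, and the almost sure limit is `Z`.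
    refine (Lp.eLpNorm_lim_le_liminf_eLpNorm (f := fun m ω => ∑ j ∈ Finset.range n, b j * Y j ω -
      ∑ j ∈ Finset.range m, b j * Y j ω) (fun m => ?_) _ ?_).trans ?_
    · have hmem : ∀ m, AEStronglyMeasurable (fun ω => ∑ j ∈ Finset.range m, b j * Y j ω) P :=
        fun m => (memLp_finsetSum (p := 2) _ fun j _ =>
          (hY j).const_mul (b j)).aestronglyMeasurable
      exact (hmem n).sub (hmem m)
    · filter_upwards [hZ] with ω hω using hω.const_sub _
    · exact liminf_le_of_frequently_le'
        ((eventually_ge_atTop n).mono hle).frequently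
  refine tendsto_of_tendsto_of_tendsto_of_le_of_le tendsto_const_nhds ?_ (fun _ => zero_le)
    hbound
  have h := ((tendsto_sum_nat_add fun j => b j ^ 2).const_mul v).sqrt
  simpa using ENNReal.tendsto_ofReal h

end MeanSquare

/-! ### Pathwise smoothness and termwise differentiation -/

section Pathwise

lemma derivPartialSum_zero {Ω : Type*} (X : ℤ → Ω → ℝ) (t : ℤ) (d c : ℝ) (n : ℕ) (ω : Ω) :
    derivPartialSum X t 0 d c n ω = ∑ j ∈ Finset.Icc 1 n, coef c d j * X (t - (j : ℤ)) ω := by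
  simp [derivPartialSum]

variable {Ω : Type*} [MeasurableSpace Ω] {P : Measure Ω}

/-- Almost surely, `∑ j ^ (d - 1) X_{t-j}` is a smooth function of `d` which can be differentiated
term by term. -/
lemma IsStationaryLARCH.ae_exists_contDiffOn {ε X s : ℤ → Ω → ℝ} {a : ℝ} {b : ℕ → ℝ}
    (hε : IsInnovation P ε) (hX : IsStationaryLARCH P ε a b X s) (t : ℤ) {r : ℝ} (hr : r < 1 / 2) :
    ∃ H : Ω → ℝ → ℝ, ∀ᵐ ω ∂P, ContDiffOn ℝ ((⊤ : ℕ∞) : WithTop ℕ∞) (H ω) (Set.Iio r) ∧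
      ∀ c : ℝ, ∀ k : ℕ, ∀ d < r, Tendsto (fun n => derivPartialSum X t k d c n ω) atTop
        (𝓝 (c * iteratedDeriv k (H ω) d)) := by
  have h : ∀ᵐ ω ∂P, ∃ H : ℝ → ℝ, ContDiffOn ℝ ((⊤ : ℕ∞) : WithTop ℕ∞) H (Set.Iio r) ∧
      ∀ c : ℝ, ∀ k : ℕ, ∀ d < r, Tendsto (fun n => derivPartialSum X t k d c n ω) atTop
        (𝓝 (c * iteratedDeriv k H d)) := by
    filter_upwards [hX.ae_exists_abs_sum_le_rpow hε t (γ := 1 - r) (by linarith)] with ω ⟨K, hK⟩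
    obtain ⟨H, hH, hlim⟩ := exists_contDiffOn_dirichlet (by linarith) hK
    rw [sub_sub_cancel] at hH hlim
    refine ⟨H, hH, fun c k d hd => ((hlim k d hd).const_mul c).congr fun n => ?_⟩
    have hsm : ∀ j ∈ Finset.Icc 1 n, ∀ c, ContDiffAt ℝ k (fun y => coef c y j) d := fun j hj c =>
      (contDiff_coef c (Finset.mem_Icc.1 hj).1).contDiffAt
    -- Here `X_{t-j}` plays the role of the scale `c` in `coef`.
    have h1 : (fun y : ℝ => ∑ j ∈ Finset.Icc 1 n, X (t - (j : ℤ)) ω * (j : ℝ) ^ (y - 1)) =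
        fun y => ∑ j ∈ Finset.Icc 1 n, coef (X (t - (j : ℤ)) ω) y j := rfl
    rw [h1, iteratedDeriv_fun_sum fun j hj => hsm j hj _, Finset.mul_sum, derivPartialSum]
    refine Finset.sum_congr rfl fun j hj => ?_
    rw [iteratedDeriv_coef _ (Finset.mem_Icc.1 hj).1, iteratedDeriv_coef _ (Finset.mem_Icc.1 hj).1]
    ring
  exact Filter.skolem.1 h

/-- `H` is smooth on an open set around `d`, so one-sided derivatives at end points are ordinary
ones; `k ≥ 1` removes the intercept. -/
lemma partialD_eq_of_eqOn {Θ : Set (ℝ × ℝ × ℝ)} {f : ℝ × ℝ × ℝ → ℝ} {H : ℝ → ℝ} {r c a d : ℝ}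
    (hH : ContDiffOn ℝ ((⊤ : ℕ∞) : WithTop ℕ∞) H (Set.Iio r))
    (hf : Set.EqOn f (fun θ => θ.2.2 + θ.2.1 * H θ.1) Θ)
    (hu : UniqueDiffOn ℝ (dSection Θ c a)) (hd : (d, c, a) ∈ Θ) (hdr : d < r) {k : ℕ}
    (hk : 1 ≤ k) : partialD Θ k f d c a = c * iteratedDeriv k H d := by
  have hHd : ContDiffAt ℝ k H d :=
    (hH.contDiffAt (Iio_mem_nhds hdr)).of_le (by exact_mod_cast le_top)
  have hcongr : Set.EqOn (fun d' => f (d', c, a)) (fun d' => a + c * H d') (dSection Θ c a) :=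
    fun d' hd' => hf hd'
  rw [partialD, iteratedDerivWithin_congr hcongr hd,
    iteratedDerivWithin_eq_iteratedDeriv hu (contDiffAt_const.add (contDiffAt_const.mul hHd)) hd,
    iteratedDeriv_const_add hk, iteratedDeriv_const_mul _ hHd]

end Pathwise

end LARCH

/-! ### The main theorem -/

theorem proposition2 {Ω : Type*} [MeasurableSpace Ω] (P : Measure Ω) [IsProbabilityMeasure P]
    (C d_u a_d a_u : ℝ) (hC0 : 0 < C) (hC1 : C < 1) (hdu : d_u < 1 / 2)
    (had : 0 < a_d) (hau : a_d < a_u)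
    (ε X s : ℤ → Ω → ℝ) (hε : LARCH.IsInnovation P ε)
    (d₀ c₀ a₀ : ℝ) (hθ₀ : (d₀, c₀, a₀) ∈ LARCH.paramSet C d_u a_d a_u)
    (hX : LARCH.IsStationaryLARCH P ε a₀ (LARCH.coef c₀ d₀) X s)
    (σ : ℤ → ℝ × ℝ × ℝ → Ω → ℝ)
    (hσm : ∀ t, ∀ θ ∈ LARCH.paramSet C d_u a_d a_u, Measurable (σ t θ))
    (hσ : ∀ t d c a, (d, c, a) ∈ LARCH.paramSet C d_u a_d a_u →
      LARCH.IsVolatilitySum P X a (LARCH.coef c d) t (σ t (d, c, a)))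
    (hS : ∀ t, LARCH.IsSeparableProcess P (LARCH.paramSet C d_u a_d a_u) (σ t)) :
    ∀ t : ℤ,
      (∀ᵐ ω ∂P,
        ContDiffOn ℝ ((⊤ : ℕ∞) : WithTop ℕ∞) (fun θ => σ t θ ω) (LARCH.paramSet C d_u a_d a_u) ∧
        ∀ d c a, (d, c, a) ∈ LARCH.paramSet C d_u a_d a_u →
          (LARCH.dSection (LARCH.paramSet C d_u a_d a_u) c a).Nontrivial →
          ∀ k : ℕ, 1 ≤ k →
            Tendsto (fun n => LARCH.derivPartialSum X t k d c n ω) atTop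
              (𝓝 (LARCH.partialD (LARCH.paramSet C d_u a_d a_u) k
                (fun θ => σ t θ ω) d c a))) ∧
      (∀ d c a, (d, c, a) ∈ LARCH.paramSet C d_u a_d a_u →
        (LARCH.dSection (LARCH.paramSet C d_u a_d a_u) c a).Nontrivial →
        ∀ k : ℕ, 1 ≤ k →
          Tendsto (fun n => eLpNorm (fun ω => LARCH.derivPartialSum X t k d c n ω -
              LARCH.partialD (LARCH.paramSet C d_u a_d a_u) k (fun θ => σ t θ ω) d c a) 2 P)
            atTop (𝓝 0)) := by
  intro t
  set Θ := LARCH.paramSet C d_u a_d a_u with hΘ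
  obtain ⟨r, hdr, hr⟩ := exists_between hdu
  have hΘr : ∀ θ ∈ Θ, θ.1 < r := fun θ hθ => hθ.1.2.trans_lt hdr
  obtain ⟨H, hH⟩ := hX.ae_exists_contDiffOn hε t hr
  have hsmooth : ∀ᵐ ω ∂P, ContDiffOn ℝ ((⊤ : ℕ∞) : WithTop ℕ∞)
      (fun θ : ℝ × ℝ × ℝ => θ.2.2 + θ.2.1 * H ω θ.1) Θ := by
    filter_upwards [hH] with ω hω
    have h1 : ContDiffOn ℝ ((⊤ : ℕ∞) : WithTop ℕ∞) (fun θ : ℝ × ℝ × ℝ => H ω θ.1) Θ :=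
      hω.1.comp contDiff_fst.contDiffOn hΘr
    exact contDiff_snd.snd.contDiffOn.add (contDiff_snd.fst.contDiffOn.mul h1)
  have heq : ∀ᵐ ω ∂P, Set.EqOn (fun θ => σ t θ ω) (fun θ => θ.2.2 + θ.2.1 * H ω θ.1) Θ := by
    refine (hS t).ae_eqOn (hsmooth.mono fun ω hω => hω.continuousOn) ?_
    rintro ⟨d, c, a⟩ ⟨hθ, -⟩
    -- The case `k = 0` of the pathwise limit: the partial sums also converge almost surely, and
    -- limits in probability are almost surely unique.
    refine tendstoInMeasure_ae_unique (hσ t d c a hθ)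
      (tendstoInMeasure_of_tendsto_ae (fun n => ?_) ?_)
    · refine (measurable_const.add (Finset.measurable_sum _ fun j _ => ?_)).aestronglyMeasurable
      exact (hX.measurable_X _).const_mul _
    · filter_upwards [hH] with ω hω
      have h1 := (hω.2 c 0 d (hΘr _ hθ)).const_add a
      simpa only [LARCH.derivPartialSum_zero, iteratedDeriv_zero] using h1
  have hpath : ∀ᵐ ω ∂P, ∀ d c a, (d, c, a) ∈ Θ → (LARCH.dSection Θ c a).Nontrivial →
      ∀ k : ℕ, 1 ≤ k → Tendsto (fun n => LARCH.derivPartialSum X t k d c n ω) atTop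
        (𝓝 (LARCH.partialD Θ k (fun θ => σ t θ ω) d c a)) := by
    filter_upwards [hH, heq] with ω hω hσω d c a hθ hnt k hk
    rw [LARCH.partialD_eq_of_eqOn hω.1 hσω (LARCH.uniqueDiffOn_dSection hC0.le hdu hnt) hθ
      (hΘr _ hθ) hk]
    exact hω.2 c k d (hΘr _ hθ)
  refine ⟨?_, fun d c a hθ hnt k hk => ?_⟩
  · filter_upwards [hsmooth, heq, hpath] with ω h1 h2 h3
    exact ⟨h1.congr h2, h3⟩
  · simp only [LARCH.derivPartialSum, LARCH.sum_Icc_one_eq_sum_range] at hpath ⊢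
    exact LARCH.tendsto_eLpNorm_sum_sub (Y := fun j => X (t - ((j + 1 : ℕ) : ℤ)))
      (fun j => hX.memLp_X _) (fun i j hij => hX.integral_mul_eq_zero hε (by simpa using hij))
      (fun j => hX.integral_sq_eq _)
      (LARCH.summable_iteratedDeriv_coef_sq c k ((hΘr _ hθ).trans hr))
      (hpath.mono fun ω hω => hω d c a hθ hnt k hk)
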